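/- Let $\mathsf{CH}(k,b,\ell,s)$ be cuckoo hashing with $b$ entries of capacity $\ell$, split into $k\le b$ disjoint sub-tables of (up to rounding) $b/k$ entries each, and a stash of capacity $s$. Each of $k$ hash functions $H_1,\dots,H_k$ assigns to every identifier one entry of the corresponding sub-table, and an item (identifier, value) may be stored in one of the $k$ entries assigned to its identifier or in the stash. The construction algorithm is perfect: it fails on an item set only if that set has no allocation respecting the capacities. The function $H=(H_1,\dots,H_k)$ is a random oracle (all values independent and uniform), and one oracle call returns $H(x)$. For families indexed by the security parameter $\lambda$, call the scheme for sets of size $n=n(\lambda)$ *$(Q,\varepsilon)$-robust* if for every probabilistic (possibly non-uniform) adversary with oracle access to $H$ and expected running time $O(Q)$, where every oracle call costs one step, the probability that it outputs a set of $n$ items with distinct identifiers on which the construction fails is at most $\varepsilon(\lambda)$ for all sufficiently large $\lambda$. Call it *$(\lambda,\varepsilon)$-strongly robust* if it is $(t(n,\lambda),\varepsilon)$-robust for every polynomial $t$. **Theorem.** For every constant $\alpha>1$ there is a constant $C>0$, depending only on $\alpha$, such that the following holds for all identifier and value universes. Let $f\ge 0$ with $f(\lambda)=\omega(\log\lambda)$,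 let $0<\varepsilon(\lambda)<1$, let $n=n(\lambda)$ be bounded by a polynomial in $\lambda$, let $b=\lceil\alpha n\rceil$, $\ell=1$, $s=0$, and let $k=k(\lambda)\le b$ be an integer with $k\ge C\,(f(\lambda)+\log(1/\varepsilon(\lambda)))$; in particular $k=\lceil C(f(\lambda)+\log(1/\varepsilon(\lambda)))\rceil=O(f(\lambda)+\log(1/\varepsilon(\lambda)))$ is allowed when this is at most $b$. Then $\mathsf{CH}(k,b,1,0)$ is $(\lambda,\varepsilon)$-strongly robust. -/

import Mathlib

open Filter Topology MeasureTheory Asymptotics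
open scoped ENNReal

universe u v

/-- A hashing scheme for identifier universe `U` and value universe `V`.
`Hash := U → Range` is the type of (tuples of) hash functions, `sample` is the law of the hash
functions output by the sampling algorithm, `construct H X` returns a table, or `none` on failure,
and `query H T id` returns a value, or `none`. An item is a pair (identifier, value). -/
structure HashingScheme (U : Type u) (V : Type v) where
  Range : Type
  [finiteRange : Finite Range]
  [measurableSpaceRange : MeasurableSpace Range]
  [discreteRange : DiscreteMeasurableSpace Range]
  Table : Type (max u v)
  sample : Measure (U → Range)
  [isProbabilityMeasure_sample : IsProbabilityMeasure sample]
  construct : (U → Range) → Finset (U × V) → Option Table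
  query : (U → Range) → Table → U → Option V

attribute [instance] HashingScheme.finiteRange HashingScheme.measurableSpaceRange
  HashingScheme.discreteRange HashingScheme.isProbabilityMeasure_sample

namespace Cuckoo

/-- The number of entries of the `i`-th of the `k` disjoint sub-tables into which `b` entries are
split. These numbers add up to `b`, differ by at most one, and all equal `b / k` if `k ∣ b`. -/
def subtableSize (k b : ℕ) (i : Fin k) : ℕ := (b + i) / k

/-- The value `(H₁(x), …, H_k(x))` of the `k` hash functions at one identifier: one entry in each
of the `k` sub-tables. -/
abbrev Location (k b : ℕ) : Type := (i : Fin k) → Fin (subtableSize k b i)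

theorem subtableSize_pos {k b : ℕ} (h : k ≤ b) (i : Fin k) : 0 < subtableSize k b i :=
  Nat.div_pos (by omega) (by have := i.isLt; omega)

theorem location_nonempty {k b : ℕ} (h : k ≤ b) : Nonempty (Location k b) :=
  ⟨fun i => ⟨0, subtableSize_pos h i⟩⟩

/-- A cuckoo hash table: `k` disjoint sub-tables with `b` entries in total, each entry holding at
most `ℓ` items, together with a stash holding at most `s` items. -/
structure Table (U : Type u) (V : Type v) (k b ℓ s : ℕ) where
  entry : (i : Fin k) → Fin (subtableSize k b i) → Finset (U × V)
  stash : Finset (U × V)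
  card_entry_le : ∀ i j, (entry i j).card ≤ ℓ
  card_stash_le : stash.card ≤ s

/-- `p` is stored in the stash, or in one of the `k` entries assigned to its identifier. -/
def Table.Holds {U : Type u} {V : Type v} {k b ℓ s : ℕ} (T : Table U V k b ℓ s)
    (H : U → Location k b) (p : U × V) : Prop :=
  p ∈ T.stash ∨ ∃ i : Fin k, p ∈ T.entry i (H p.1 i)

/-- `T` is a successful allocation of the item set `X` according to the hash functions `H`. -/
def Table.Allocates {U : Type u} {V : Type v} {k b ℓ s : ℕ} (T : Table U V k b ℓ s)
    (H : U → Location k b) (X : Finset (U × V)) : Prop :=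
  (∀ p ∈ X, T.Holds H p) ∧ (∀ i j, T.entry i j ⊆ X) ∧ T.stash ⊆ X

/-- The law of a random function (random oracle) `U → R` to a nonempty finite set: the values at
the points of `U` are independent and uniformly distributed. -/
noncomputable def randomFunction (U : Type u) (R : Type) [Finite R] [Nonempty R]
    [MeasurableSpace R] : Measure (U → R) :=
  letI := Fintype.ofFinite R
  Measure.infinitePi fun _ : U => (PMF.uniformOfFintype R).toMeasure

theorem isProbabilityMeasure_randomFunction (U : Type u) (R : Type) [Finite R] [Nonempty R]
    [MeasurableSpace R] : IsProbabilityMeasure (randomFunction U R) := by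
  unfold randomFunction
  infer_instance

open Classical in
/-- The cuckoo hashing scheme `CH(k, b, ℓ, s)` with random hash functions, `k` disjoint sub-tables
and a perfect construction algorithm (it finds an allocation whenever there is one). -/
noncomputable def CH (U : Type u) (V : Type v) (k b ℓ s : ℕ) (hkb : k ≤ b) :
    HashingScheme U V :=
  haveI := location_nonempty hkb
  { Range := Location k b
    Table := Table U V k b ℓ s
    sample := randomFunction U (Location k b)
    isProbabilityMeasure_sample := isProbabilityMeasure_randomFunction U (Location k b)
    construct := fun H X => if h : ∃ T : Table U V k b ℓ s, T.Allocates H X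
      then some h.choose else none
    query := fun H T x => if h : ∃ y : V, T.Holds H (x, y) then some h.choose else none }

end Cuckoo

/-- What a probabilistic oracle machine does in one time step: a local computation, a fair coin
flip, an oracle call (at unit cost), or halting with an output. -/
inductive OracleMachine.Action (σ : Type) (U : Type u) (R : Type) (O : Type v) where
  | compute (next : σ)
  | flip (next : Bool → σ)
  | call (x : U) (next : R → σ)
  | halt (out : O)

/-- A probabilistic machine with access to an oracle `U → R` and with output in `O`. The states
are the configurations of the machine, and no restriction is put on the transition function, so
every probabilistic oracle Turing machine or RAM, uniform or not, is of this form, with the same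
number of steps up to a constant factor. (A small type of states suffices: the sequence of coins and
oracle answers received so far determines the configuration.) -/
structure OracleMachine (U : Type u) (R : Type) (O : Type v) where
  State : Type
  init : State
  action : State → OracleMachine.Action State U R O

namespace OracleMachine

variable {U : Type u} {R : Type} {O : Type v}

/-- The state after `i` steps, with oracle `H` and coins `ρ`. The step number `i` reads the coin
`ρ i` if it is a coin flip. -/
def stateAt (M : OracleMachine U R O) (H : U → R) (ρ : ℕ → Bool) : ℕ → M.State
  | 0 => M.init
  | i + 1 => match M.action (M.stateAt H ρ i) with
    | .compute next => next
    | .flip next => next (ρ i)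
    | .call x next => next (H x)
    | .halt _ => M.stateAt H ρ i

/-- The machine is ready to halt with output `o` after `i` steps. -/
def HaltsAt (M : OracleMachine U R O) (H : U → R) (ρ : ℕ → Bool) (i : ℕ) (o : O) : Prop :=
  M.action (M.stateAt H ρ i) = .halt o

/-- The running time: the number of steps up to and including the halting step, and `∞` if the
machine never halts. -/
noncomputable def time (M : OracleMachine U R O) (H : U → R) (ρ : ℕ → Bool) : ℝ≥0∞ :=
  ⨅ (i : ℕ) (_ : ∃ o, M.HaltsAt H ρ i o), ((i + 1 : ℕ) : ℝ≥0∞)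

/-- The law of an infinite sequence of independent fair coins. -/
noncomputable def coins : Measure (ℕ → Bool) := Cuckoo.randomFunction ℕ Bool

end OracleMachine

namespace HashingScheme

/-- An adversary against a hashing scheme: a probabilistic machine with oracle access to the
sampled hash functions (one call returns the values of all hash functions at a point) whose output
is a set of items. -/
abbrev Adversary {U : Type u} {V : Type v} (S : HashingScheme U V) : Type (max 1 u v) :=
  OracleMachine U S.Range (Finset (U × V))

/-- The expected running time, over the sampled hash functions and the coins of the adversary. -/
noncomputable def expectedTime {U : Type u} {V : Type v} (S : HashingScheme U V)
    (A : S.Adversary) : ℝ≥0∞ :=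
  ∫⁻ p, A.time p.1 p.2 ∂(S.sample.prod OracleMachine.coins)

/-- The probability that the adversary outputs a set of `n` items with distinct identifiers for
which the construction fails. -/
noncomputable def failureProb {U : Type u} {V : Type v} (S : HashingScheme U V) (n : ℕ)
    (A : S.Adversary) : ℝ≥0∞ :=
  (S.sample.prod OracleMachine.coins)
    {p | ∃ i X, A.HaltsAt p.1 p.2 i X ∧ X.card = n ∧ Set.InjOn Prod.fst (X : Set (U × V)) ∧
      S.construct p.1 X = none}

/-- A family of hashing schemes, indexed by the security parameter `lam`, for sets of `n lam` items
is `(Q, ε)`-robust: every (possibly non-uniform) adversary whose expected running time is `O(Q)`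
causes a failure with probability at most `ε`, for all sufficiently large `lam`. -/
def IsRobust {U : ℕ → Type u} {V : ℕ → Type v} (S : ∀ lam, HashingScheme (U lam) (V lam))
    (n : ℕ → ℕ) (Q : ℕ → ℕ) (ε : ℕ → ℝ) : Prop :=
  ∀ A : ∀ lam, (S lam).Adversary,
    (∃ c : ℕ, ∀ᶠ lam in atTop, (S lam).expectedTime (A lam) ≤ ((c * Q lam : ℕ) : ℝ≥0∞)) →
    ∀ᶠ lam in atTop, (S lam).failureProb (n lam) (A lam) ≤ ENNReal.ofReal (ε lam)

/-- `(lam, ε)`-strong robustness: `(t, ε)`-robustness for every polynomial `t(n, lam)`. -/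
def IsStronglyRobust {U : ℕ → Type u} {V : ℕ → Type v}
    (S : ∀ lam, HashingScheme (U lam) (V lam)) (n : ℕ → ℕ) (ε : ℕ → ℝ) : Prop :=
  ∀ t : MvPolynomial (Fin 2) ℕ,
    IsRobust S n (fun lam => MvPolynomial.eval ![n lam, lam] t) ε

end HashingScheme

/-! A failure of the perfect construction is a violation of Hall's condition: for some s ≥ 1, s of
the output identifiers have all their hash values inside a set S of s entries
(`Cuckoo.exists_of_construct_eq_none`). For fixed S with s ≤ n, a uniform location lies in S with
probability at most p = exp(-k(b-n)/(2b)) (`Cuckoo.uniform_locationsIn_le`), and b ≥ αn makes the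
exponent at least a constant times k.

Adaptivity does not help the adversary. For fixed coins, a machine stopped after m steps and then
made to query its own output is a decision tree of depth m+n. Each query at a new point has a fresh
answer, so s distinct answers fall in S with probability at most binom(m+n, s) p^s
(`DecisionTree.infinitePi_le_hits_le`).

A union bound over the binom(b, s) sets S and over s ≤ n gives n·b(m+n)p, and Markov's inequality
adds T/m for runs longer than the cut-off, where T bounds the expected time
(`Cuckoo.failureProb_le`). Take m ≈ 2(T+1)/ε. The constant C = 4/(1-1/α) gives p ≤ ε² exp(-2f): one
factor ε cancels the 1/ε in m, the other is the target, and exp(-2f) beats the remaining polynomial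
factor since f = ω(log λ). -/

/-! ### Resampling and independence in product measures. -/

section RandomFunction

variable {U : Type u} {R : Type} [MeasurableSpace R]

open Classical in
/-- Resampling one coordinate preserves a product measure. -/
theorem measurePreserving_update_infinitePi (ν : Measure R) [IsProbabilityMeasure ν] (x : U) :
    MeasurePreserving (fun p : R × (U → R) => Function.update p.2 x p.1)
      (ν.prod (Measure.infinitePi fun _ : U => ν)) (Measure.infinitePi fun _ : U => ν) := by
  have hmeas : Measurable (fun p : R × (U → R) => Function.update p.2 x p.1) := by
    refine measurable_pi_lambda _ fun y => ?_
    by_cases h : y = x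
    · subst h; simpa using measurable_fst
    · simpa [h] using measurable_snd.eval (a := y)
  refine ⟨hmeas, Measure.eq_infinitePi _ fun s t ht => ?_⟩
  rw [Measure.map_apply hmeas (MeasurableSet.pi s.countable_toSet fun i _ => ht i)]
  by_cases hx : x ∈ s
  · have : (fun p : R × (U → R) => Function.update p.2 x p.1) ⁻¹' (s : Set U).pi t =
        t x ×ˢ ((s.erase x : Finset U) : Set U).pi t := by
      ext p
      simp only [Set.mem_preimage, Set.mem_pi, Set.mem_prod, Finset.mem_coe, Finset.mem_erase]
      constructor
      · refine fun h => ⟨by simpa using h x hx, fun i hi => by simpa [hi.1] using h i hi.2⟩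
      · rintro ⟨h1, h2⟩ i hi
        by_cases hix : i = x
        · subst hix; simpa using h1
        · simpa [hix] using h2 i ⟨hix, hi⟩
    rw [this, Measure.prod_prod, Measure.infinitePi_pi _ fun i _ => ht i,
      Finset.mul_prod_erase s (fun i => ν (t i)) hx]
  · have : (fun p : R × (U → R) => Function.update p.2 x p.1) ⁻¹' (s : Set U).pi t =
        Set.univ ×ˢ (s : Set U).pi t := by
      ext p
      simp only [Set.mem_preimage, Set.mem_pi, Set.mem_prod, Finset.mem_coe, Set.mem_univ, true_and]
      refine forall₂_congr fun i hi => ?_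
      have : i ≠ x := fun h => hx (h ▸ hi)
      simp [this]
    rw [this, Measure.prod_prod, Measure.infinitePi_pi _ fun i _ => ht i]
    simp

open Classical in
/-- Under a product measure, one coordinate is independent of any event that ignores it. -/
theorem infinitePi_eval_inter (ν : Measure R) [IsProbabilityMeasure ν] (x : U) {B : Set R}
    (hB : MeasurableSet B) {E : Set (U → R)} (hE : MeasurableSet E)
    (hinv : ∀ H r, Function.update H x r ∈ E ↔ H ∈ E) :
    Measure.infinitePi (fun _ : U => ν) ({H | H x ∈ B} ∩ E) =
      ν B * Measure.infinitePi (fun _ : U => ν) E := by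
  have hmp := measurePreserving_update_infinitePi ν x
  have hm : MeasurableSet ({H : U → R | H x ∈ B} ∩ E) := (measurable_pi_apply x hB).inter hE
  -- Pulled back along the resampling map, the event becomes the rectangle `B ×ˢ E`, because `E`
  -- ignores the coordinate `x`.
  rw [← hmp.measure_preimage hm.nullMeasurableSet, ← Measure.prod_prod]
  congr 1
  ext p
  simp [hinv]

end RandomFunction

/-! ### Tail bounds for adaptive queries. -/

/-- A decision tree that makes adaptive queries in `U` with answers in `R`. -/
inductive DecisionTree (U : Type u) (R : Type)
  | leaf : DecisionTree U R
  | query (x : U) (next : R → DecisionTree U R) : DecisionTree U R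

namespace DecisionTree

variable {U : Type u} {R : Type}

/-- Every branch makes at most `m` queries. -/
def DepthLE : DecisionTree U R → ℕ → Prop
  | leaf, _ => True
  | query _ _, 0 => False
  | query _ next, m + 1 => ∀ r, (next r).DepthLE m

theorem DepthLE.mono {t : DecisionTree U R} {m m' : ℕ} (h : t.DepthLE m) (hm : m ≤ m') :
    t.DepthLE m' := by
  induction t generalizing m m' with
  | leaf => trivial
  | query x next ih =>
    cases m with
    | zero => exact h.elim
    | succ m =>
      obtain ⟨m', rfl⟩ : ∃ j, m' = j + 1 := ⟨m' - 1, by omega⟩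
      exact fun r => ih r (h r) (by omega)

/-- The points that are queried with oracle `H`. -/
def queried (H : U → R) : DecisionTree U R → Set U
  | leaf => ∅
  | query x next => insert x ((next (H x)).queried H)

/-- The tree that queries all points of a list. -/
def ofList : List U → DecisionTree U R
  | [] => leaf
  | x :: l => query x fun _ => ofList l

theorem depthLE_ofList (l : List U) : (ofList l : DecisionTree U R).DepthLE l.length := by
  induction l with
  | nil => trivial
  | cons x l ih => exact fun _ => ih

theorem mem_queried_ofList (H : U → R) {l : List U} {x : U} (h : x ∈ l) :
    x ∈ (ofList l).queried H := by
  induction l with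
  | nil => simp at h
  | cons y l ih =>
    rcases List.mem_cons.1 h with rfl | h
    · exact Set.mem_insert _ _
    · exact Set.mem_insert_of_mem _ (ih h)

open Classical in
/-- The number of answers in `A` to the queries at distinct new points, where `g` holds the answers
that are known already. -/
noncomputable def hits (A : Set R) (H : U → R) : DecisionTree U R → (U → Option R) → ℕ
  | leaf, _ => 0
  | query x next, g => match g x with
    | some r => (next r).hits A H g
    | none => (if H x ∈ A then 1 else 0) + (next (H x)).hits A H (Function.update g x (some (H x)))

/-- Recorded points are answered from `g` and never read from the oracle. Hence, once the answer at
`x` is recorded, the count in the subtree is independent of `H x`. -/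
theorem hits_congr (A : Set R) {H H' : U → R} (t : DecisionTree U R) (g : U → Option R)
    (h : ∀ x, g x = none → H x = H' x) : t.hits A H g = t.hits A H' g := by
  classical
  induction t generalizing g with
  | leaf => rfl
  | query x next ih =>
    rcases hg : g x with _ | r
    · simp only [hits, hg, h x hg]
      congr 1
      refine ih _ _ fun y hy => h y ?_
      by_cases hyx : y = x
      · subst hyx; exact hg
      · simpa [hyx] using hy
    · simp only [hits, hg]
      exact ih _ _ h

/-- As long as the record `g` agrees with `H`, the count follows the true branch of the tree, and
each point of `Y` is counted when it is first queried. -/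
theorem card_le_hits (A : Set R) (H : U → R) (t : DecisionTree U R) (g : U → Option R)
    (hg : ∀ x r, g x = some r → H x = r) (Y : Finset U)
    (hY : ∀ x ∈ Y, x ∈ t.queried H ∧ g x = none ∧ H x ∈ A) : Y.card ≤ t.hits A H g := by
  classical
  induction t generalizing g Y with
  | leaf =>
    have : Y = ∅ := Finset.eq_empty_of_forall_notMem fun x hx => (hY x hx).1
    simp [this]
  | query x next ih =>
    rcases hgx : g x with _ | r
    · simp only [hits, hgx]
      have key := ih (H x) (Function.update g x (some (H x))) (fun y r hy => by
        by_cases hyx : y = x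
        · subst hyx; simpa using hy
        · exact hg y r (by simpa [hyx] using hy)) (Y.erase x) (fun y hy => by
        obtain ⟨hne, hy⟩ := Finset.mem_erase.1 hy
        obtain ⟨h1, h2, h3⟩ := hY y hy
        exact ⟨h1.resolve_left hne, by simpa [hne] using h2, h3⟩)
      by_cases hx : x ∈ Y
      · rw [if_pos (hY x hx).2.2, ← Finset.card_erase_add_one hx]
        omega
      · rw [Finset.erase_eq_of_notMem hx] at key
        omega
    · simp only [hits, hgx]
      refine ih r g hg Y fun y hy => ?_
      obtain ⟨h1, h2, h3⟩ := hY y hy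
      refine ⟨?_, h2, h3⟩
      rcases h1 with rfl | h1
      · simp [h2] at hgx
      · rwa [hg x r hgx] at h1

variable [Finite R] [MeasurableSpace R] [DiscreteMeasurableSpace R]

/-- The evaluation at a point, as a simple function of the oracle. -/
def evalSimple (x : U) : SimpleFunc (U → R) R where
  toFun H := H x
  measurableSet_fiber' r := measurable_pi_apply x (MeasurableSet.of_discrete (s := {r}))
  finite_range' := Set.toFinite _

theorem measurableSet_le_hits (A : Set R) (t : DecisionTree U R) (g : U → Option R) (s : ℕ) :
    MeasurableSet {H : U → R | s ≤ t.hits A H g} := by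
  classical
  induction t generalizing g s with
  | leaf => exact MeasurableSet.const (s ≤ 0)
  | query x next ih =>
    rcases hg : g x with _ | r
    · simp only [hits, hg]
      refine (evalSimple (R := R) x).measurableSet_cut (fun H r => s ≤ (if r ∈ A then 1 else 0) +
        (next r).hits A H (Function.update g x (some r))) fun r => ?_
      -- Truncated subtraction moves the contribution of the current answer into the threshold, so
      -- the induction hypothesis applies.
      simp only [← tsub_le_iff_left]
      exact ih _ _ _
    · simp only [hits, hg]
      exact ih _ _ _

/-- The number of distinct queries with an answer in `A` has binomial tails, although the queries
are adaptive. -/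
theorem infinitePi_le_hits_le (ν : Measure R) [IsProbabilityMeasure ν] (A : Set R)
    (t : DecisionTree U R) (g : U → Option R) (s : ℕ) {m : ℕ} (hm : t.DepthLE m) :
    Measure.infinitePi (fun _ : U => ν) {H | s ≤ t.hits A H g} ≤ m.choose s * ν A ^ s := by
  classical
  induction t generalizing g s m with
  | leaf =>
    cases s with
    | zero => simp
    | succ s => simp [hits]
  | query x next ih =>
    obtain ⟨m, rfl⟩ : ∃ j, m = j + 1 := by
      cases m with
      | zero => exact hm.elim
      | succ m => exact ⟨m, rfl⟩
    rcases hg : g x with _ | r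
    swap
    -- A repeated query uses up depth without a hit, and the binomial coefficient is monotone in its
    -- upper index.
    · simp only [hits, hg]
      refine (ih r g s (hm r)).trans ?_
      gcongr
      omega
    cases s with
    | zero => simp
    | succ s =>
    let := Fintype.ofFinite R
    simp only [hits, hg]
    set g' : R → U → Option R := fun r => Function.update g x (some r)
    set E : R → ℕ → Set (U → R) := fun r j => {H | j ≤ (next r).hits A H (g' r)}
    have hE : ∀ (B : Set R) r j, Measure.infinitePi (fun _ : U => ν) ({H | H x ∈ B} ∩ E r j) =
        ν B * Measure.infinitePi (fun _ : U => ν) (E r j) := fun B r j => by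
      refine infinitePi_eval_inter ν x .of_discrete (measurableSet_le_hits _ _ _ _) fun H r' => ?_
      change j ≤ _ ↔ j ≤ _
      rw [hits_congr]
      intro y hy
      have : y ≠ x := fun h => by subst h; simp [g'] at hy
      simp [this]
    -- Split by the answer `r` at `x`: an answer in `A` leaves `s` hits to find; for any other
    -- answer `s + 1` remain. The second union may run over all `r`, which Pascal's rule absorbs.
    have hsub : {H : U → R | s + 1 ≤ (if H x ∈ A then 1 else 0) +
        (next (H x)).hits A H (Function.update g x (some (H x)))} ⊆
        (⋃ r ∈ A.toFinset, {H | H x ∈ ({r} : Set R)} ∩ E r s) ∪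
          ⋃ r, {H | H x ∈ ({r} : Set R)} ∩ E r (s + 1) := by
      intro H hH
      simp only [Set.mem_ofPred_eq] at hH
      by_cases hA : H x ∈ A
      · rw [if_pos hA] at hH
        exact Or.inl (Set.mem_biUnion (x := H x) (by simpa using hA)
          ⟨rfl, show s ≤ (next (H x)).hits A H (Function.update g x (some (H x))) by omega⟩)
      · rw [if_neg hA, zero_add] at hH
        exact Or.inr (Set.mem_iUnion.2 ⟨H x, rfl, hH⟩)
    have hsumA : ∑ r ∈ A.toFinset, ν {r} = ν A := by simp
    have hsum : ∑ r, ν {r} = 1 := by simp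
    calc _ ≤ ∑ r ∈ A.toFinset, ν {r} * (m.choose s * ν A ^ s) +
          ∑ r, ν {r} * (m.choose (s + 1) * ν A ^ (s + 1)) := by
          refine (measure_mono hsub).trans ((measure_union_le _ _).trans (add_le_add ?_ ?_))
          · refine (measure_biUnion_finset_le _ _).trans (Finset.sum_le_sum fun r _ => ?_)
            rw [hE]
            gcongr
            exact ih r _ _ (hm r)
          · refine (measure_iUnion_fintype_le _ _).trans (Finset.sum_le_sum fun r _ => ?_)
            rw [hE]
            gcongr
            exact ih r _ _ (hm r)
      _ = _ := by
          rw [← Finset.sum_mul, ← Finset.sum_mul, hsumA, hsum, Nat.choose_succ_succ]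
          push_cast
          ring

end DecisionTree

/-! ### From oracle machines to decision trees. -/

namespace OracleMachine

variable {U : Type u} {R : Type} {O : Type v} (M : OracleMachine U R O)

theorem HaltsAt.stateAt_eq {M : OracleMachine U R O} {H : U → R} {ρ : ℕ → Bool} {i j : ℕ} {o : O}
    (h : M.HaltsAt H ρ i o) (hij : i ≤ j) : M.stateAt H ρ j = M.stateAt H ρ i := by
  induction j, hij using Nat.le_induction with
  | base => rfl
  | succ j hij ih =>
    unfold HaltsAt at h
    simp only [stateAt, ih, h]

theorem HaltsAt.haltsAt_of_le {M : OracleMachine U R O} {H : U → R} {ρ : ℕ → Bool} {i j : ℕ}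
    {o : O} (h : M.HaltsAt H ρ i o) (hij : i ≤ j) : M.HaltsAt H ρ j o := by
  unfold HaltsAt
  rw [h.stateAt_eq hij]
  exact h

theorem HaltsAt.output_eq {M : OracleMachine U R O} {H : U → R} {ρ : ℕ → Bool} {i j : ℕ} {o o' : O}
    (h : M.HaltsAt H ρ i o) (h' : M.HaltsAt H ρ j o') : o = o' := by
  have h1 := h.haltsAt_of_le (le_max_left i j)
  have h2 := h'.haltsAt_of_le (le_max_right i j)
  unfold HaltsAt at h1 h2
  simpa using h1.symm.trans h2

theorem le_time_of_not_haltsAt {H : U → R} {ρ : ℕ → Bool} {m : ℕ}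
    (h : ¬ ∃ o, M.HaltsAt H ρ m o) : (m : ℝ≥0∞) ≤ M.time H ρ := by
  refine le_iInf₂ fun i hi => ?_
  obtain ⟨o, ho⟩ := hi
  have : m < i := by
    by_contra! hle
    exact h ⟨o, ho.haltsAt_of_le hle⟩
  exact_mod_cast (by omega : m ≤ i + 1)

/-- The queries of a machine with coins `ρ`, started in state `s` before step `i` and run for `m`
steps, followed by the queries of `out o` if it is then ready to halt with output `o`. -/
def tree (out : O → DecisionTree U R) (ρ : ℕ → Bool) : ℕ → ℕ → M.State → DecisionTree U R
  | _, 0, s => match M.action s with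
    | .halt o => out o
    | _ => .leaf
  | i, m + 1, s => match M.action s with
    | .compute next => tree out ρ (i + 1) m next
    | .flip next => tree out ρ (i + 1) m (next (ρ i))
    | .call x next => .query x fun r => tree out ρ (i + 1) m (next r)
    | .halt _ => tree out ρ (i + 1) m s

theorem depthLE_tree (out : O → DecisionTree U R) {n : ℕ} (hout : ∀ o, (out o).DepthLE n)
    (ρ : ℕ → Bool) (i m : ℕ) (s : M.State) : (M.tree out ρ i m s).DepthLE (m + n) := by
  induction m generalizing i s with
  | zero =>
    rw [tree]
    split
    · rw [zero_add]; exact hout _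
    · trivial
  | succ m ih =>
    rw [tree, Nat.add_right_comm]
    split
    · exact (ih _ _).mono (Nat.le_succ _)
    · exact (ih _ _).mono (Nat.le_succ _)
    · exact fun r => ih _ _
    · exact (ih _ _).mono (Nat.le_succ _)

theorem HaltsAt.queried_subset {M : OracleMachine U R O} (out : O → DecisionTree U R) {H : U → R}
    {ρ : ℕ → Bool} {i m : ℕ} {o : O} (h : M.HaltsAt H ρ (i + m) o) :
    (out o).queried H ⊆ (M.tree out ρ i m (M.stateAt H ρ i)).queried H := by
  induction m generalizing i with
  | zero =>
    unfold HaltsAt at h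
    rw [add_zero] at h
    simp only [tree, h]
    rfl
  | succ m ih =>
    have key := ih (i := i + 1) (by rwa [Nat.add_right_comm])
    rw [stateAt] at key
    rw [tree]
    split <;> rename_i heq <;> simp only [heq] at key
    · exact key
    · exact key
    · exact key.trans (Set.subset_insert _ _)
    · exact key

variable [Finite R] [MeasurableSpace R] [DiscreteMeasurableSpace R]

/-- The state after `i` steps takes finitely many values, each on a measurable set. -/
theorem exists_simpleFunc_stateAt (i : ℕ) :
    ∃ F : SimpleFunc ((U → R) × (ℕ → Bool)) M.State, ∀ p, F p = M.stateAt p.1 p.2 i := by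
  induction i with
  | zero => exact ⟨SimpleFunc.const _ M.init, fun p => rfl⟩
  | succ i ih =>
    obtain ⟨F, hF⟩ := ih
    -- Only finitely many states are reachable after `i` steps, so `bind` can branch on them without
    -- a measurable structure on `M.State`.
    refine ⟨F.bind fun s => match M.action s with
      | .compute next => SimpleFunc.const _ next
      | .flip next => (((DecisionTree.evalSimple i).comp Prod.snd measurable_snd).map next)
      | .call x next => (((DecisionTree.evalSimple x).comp Prod.fst measurable_fst).map next)
      | .halt _ => SimpleFunc.const _ s, fun p => ?_⟩
    rw [SimpleFunc.bind_apply, hF, stateAt]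
    cases h : M.action (M.stateAt p.1 p.2 i) <;> simp [DecisionTree.evalSimple, SimpleFunc.comp]

theorem measurableSet_haltsAt (m : ℕ) (Q : O → (U → R) → Prop)
    (hQ : ∀ o, MeasurableSet {H | Q o H}) :
    MeasurableSet {p : (U → R) × (ℕ → Bool) | ∃ o, M.HaltsAt p.1 p.2 m o ∧ Q o p.1} := by
  obtain ⟨F, hF⟩ := M.exists_simpleFunc_stateAt m
  have := F.measurableSet_cut (fun p s => ∃ o, M.action s = .halt o ∧ Q o p.1) fun s => by
    cases h : M.action s with
    | halt o => simpa using measurable_fst (hQ o)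
    | _ => simp
  simpa only [hF, HaltsAt] using this

/-- Markov's inequality for the running time. -/
theorem measure_not_haltsAt_le (P : Measure ((U → R) × (ℕ → Bool))) (m : ℕ) :
    m * P {p | ¬ ∃ o, M.HaltsAt p.1 p.2 m o} ≤ ∫⁻ p, M.time p.1 p.2 ∂P := by
  have hm : MeasurableSet {p : (U → R) × (ℕ → Bool) | ¬ ∃ o, M.HaltsAt p.1 p.2 m o} := by
    refine MeasurableSet.compl (s := {p : (U → R) × (ℕ → Bool) | ∃ o, M.HaltsAt p.1 p.2 m o}) ?_
    simpa using M.measurableSet_haltsAt m (fun _ _ => True) fun _ => .const _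
  rw [← lintegral_indicator_const hm]
  refine lintegral_mono fun p => ?_
  by_cases hp : p ∈ {p : (U → R) × (ℕ → Bool) | ¬ ∃ o, M.HaltsAt p.1 p.2 m o}
  · rw [Set.indicator_of_mem hp]
    exact M.le_time_of_not_haltsAt hp
  · rw [Set.indicator_of_notMem hp]
    exact zero_le

/-- With an oracle whose values are independent with law `ν`, a machine that has halted after `m`
steps and then queries the at most `n` points of `ids o` hardly finds many distinct points with an
answer in `A`. -/
theorem measure_haltsAt_le (ν : Measure R) [IsProbabilityMeasure ν] (κ : Measure (ℕ → Bool))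
    [IsProbabilityMeasure κ] (ids : O → Finset U) (n m s : ℕ) (A : Set R) :
    ((Measure.infinitePi fun _ : U => ν).prod κ) {p | ∃ o, M.HaltsAt p.1 p.2 m o ∧
        (ids o).card ≤ n ∧ ∃ Y ⊆ ids o, s ≤ Y.card ∧ ∀ x ∈ Y, p.1 x ∈ A} ≤
      (m + n).choose s * ν A ^ s := by
  classical
  have hmeas := M.measurableSet_haltsAt m
    (fun o H => (ids o).card ≤ n ∧ ∃ Y ⊆ ids o, s ≤ Y.card ∧ ∀ x ∈ Y, H x ∈ A) fun o => by
      refine (MeasurableSet.const ((ids o).card ≤ n)).inter ?_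
      have : {H : U → R | ∃ Y ⊆ ids o, s ≤ Y.card ∧ ∀ x ∈ Y, H x ∈ A} =
          ⋃ Y ∈ (ids o).powerset.filter (s ≤ ·.card), ⋂ x ∈ Y, {H | H x ∈ A} := by
        ext H
        simp [and_assoc]
      refine Eq.mpr (congrArg _ this) ?_
      exact Finset.measurableSet_biUnion _ fun Y _ => Finset.measurableSet_biInter _ fun x _ =>
        measurable_pi_apply x .of_discrete
  -- Fixing the coins makes the machine a deterministic decision tree.
  rw [Measure.prod_apply_symm hmeas]
  -- Querying the output afterwards covers identifiers the machine never asked about. Oversized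
  -- outputs get a leaf, which keeps the depth at most `m + n`.
  set out : O → DecisionTree U R := fun o =>
    if (ids o).card ≤ n then .ofList (ids o).toList else .leaf
  have hout : ∀ o, (out o).DepthLE n := fun o => by
    by_cases h : (ids o).card ≤ n
    · simpa [out, h] using (DecisionTree.depthLE_ofList (R := R) (ids o).toList).mono (by simpa)
    · simp [out, h, DecisionTree.DepthLE]
  calc _ ≤ ∫⁻ _, ((m + n).choose s * ν A ^ s : ℝ≥0∞) ∂κ := lintegral_mono fun ρ => by
        refine (measure_mono ?_).trans (DecisionTree.infinitePi_le_hits_le ν A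
          (M.tree out ρ 0 m M.init) (fun _ => none) s (M.depthLE_tree out hout ρ 0 m M.init))
        rintro H ⟨o, ho, hn, Y, hY, hs, hA⟩
        refine hs.trans (DecisionTree.card_le_hits A H _ _ (by simp) Y fun x hx =>
          ⟨?_, rfl, hA x hx⟩)
        have hsub := HaltsAt.queried_subset (M := M) out (i := 0) (m := m) (by simpa using ho)
        refine hsub ?_
        simp only [out, if_pos hn]
        exact DecisionTree.mem_queried_ofList H (by simpa using hY hx)
    _ = _ := by simp

end OracleMachine

/-! ### Hall violations and their probability. -/

namespace Cuckoo

theorem sum_subtableSize {k : ℕ} (hk : 0 < k) (b : ℕ) : ∑ i, subtableSize k b i = b := by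
  have key : ∑ i ∈ Finset.range k, (b + i) / k = b := by
    induction b with
    | zero =>
      refine Finset.sum_eq_zero fun i hi => ?_
      rw [zero_add]
      exact Nat.div_eq_of_lt (Finset.mem_range.1 hi)
    | succ b ih =>
      -- Raising `b` by one shifts the window of summation: the term `b / k` leaves and `(b + k) / k
      -- = b / k + 1` enters.
      have h1 := Finset.sum_range_succ (fun i => (b + i) / k) k
      rw [Finset.sum_range_succ', ih, Nat.add_div_right _ hk, add_zero] at h1
      have h2 : ∑ i ∈ Finset.range k, (b + 1 + i) / k = ∑ i ∈ Finset.range k, (b + (i + 1)) / k :=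
        Finset.sum_congr rfl fun i _ => by rw [add_assoc, add_comm 1 i]
      omega
  rw [Finset.sum_range] at key
  exact key

/-- The set of all entries of the sub-tables. -/
abbrev Entry (k b : ℕ) : Type := (i : Fin k) × Fin (subtableSize k b i)

theorem card_entry {k : ℕ} (hk : 0 < k) (b : ℕ) : Fintype.card (Entry k b) = b := by
  simp [Fintype.card_sigma, sum_subtableSize hk]

/-- The hash values all of whose entries are in `S`. -/
def locationsIn {k b : ℕ} (S : Finset (Entry k b)) : Set (Location k b) :=
  {r | ∀ i, ⟨i, r i⟩ ∈ S}

open Classical in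
/-- If the construction fails, then by Hall's theorem some identifiers have too few entries. -/
theorem exists_of_construct_eq_none {U : Type u} {V : Type v} {k b : ℕ} (hkb : k ≤ b) (hk : 0 < k)
    {H : U → Location k b} {X : Finset (U × V)} (hX : X.card ≤ b)
    (hinj : Set.InjOn Prod.fst (X : Set (U × V)))
    (hfail : (CH U V k b 1 0 hkb).construct H X = none) :
    ∃ Y ⊆ X.image Prod.fst, 0 < Y.card ∧
      ∃ S : Finset (Entry k b), S.card = Y.card ∧ ∀ x ∈ Y, H x ∈ locationsIn S := by
  by_contra! hno
  have hall : ∀ Z : Finset X, Z.card ≤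
      (Z.biUnion fun p => Finset.univ.image fun i => (⟨i, H p.1.1 i⟩ : Entry k b)).card := by
    intro Z
    by_contra! hlt
    set N := Z.biUnion fun p => Finset.univ.image fun i => (⟨i, H p.1.1 i⟩ : Entry k b)
    have hinj' : Set.InjOn (fun p : X => p.1.1) (Z : Set X) := fun p _ q _ h =>
      Subtype.ext (hinj p.2 q.2 h)
    have hcard : (Z.image fun p => p.1.1).card = Z.card := Finset.card_image_of_injOn hinj'
    have hZX : Z.card ≤ X.card := by simpa using Finset.card_le_univ Z
    -- Pad the neighbourhood to exactly `Z.card` entries; there is room because `Z.card ≤ X.card ≤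
    -- b`.
    obtain ⟨S, hNS, hS⟩ := Finset.exists_superset_card_eq hlt.le
      (by rw [card_entry hk]; omega)
    obtain ⟨x, hx, hxS⟩ := hno (Z.image fun p => p.1.1)
      (fun x hx => by
        obtain ⟨p, _, rfl⟩ := Finset.mem_image.1 hx
        exact Finset.mem_image_of_mem _ p.2)
      (by omega) S (by omega)
    obtain ⟨p, hp, rfl⟩ := Finset.mem_image.1 hx
    exact hxS fun i => hNS (Finset.mem_biUnion.2
      ⟨p, hp, Finset.mem_image_of_mem (fun i => (⟨i, H p.1.1 i⟩ : Entry k b)) (Finset.mem_univ i)⟩)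
  obtain ⟨e, he, hmem⟩ := (Finset.all_card_le_biUnion_card_iff_exists_injective _).1 hall
  have hT : ∃ T : Table U V k b 1 0, T.Allocates H X := by
    refine ⟨⟨fun i j => (Finset.univ.filter fun p : X => e p = ⟨i, j⟩).map (.subtype _), ∅,
      fun i j => ?_, by simp⟩, fun p hp => Or.inr ?_, fun i j p hp => ?_, by simp⟩
    · rw [Finset.card_map, Finset.card_le_one]
      intro p hp q hq
      exact he ((Finset.mem_filter.1 hp).2.trans (Finset.mem_filter.1 hq).2.symm)
    · obtain ⟨i, -, hi⟩ := Finset.mem_image.1 (hmem ⟨p, hp⟩)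
      exact ⟨i, by simpa using ⟨hp, hi.symm⟩⟩
    · obtain ⟨q, -, rfl⟩ := Finset.mem_map.1 hp
      exact q.2
  simp [CH, hT] at hfail

/-- Each factor is 1 minus its missing fraction, and 1 - x ≤ exp(-x). Since `i < k ≤ b`, a sub-table
has at most 2b/k entries, so every missing entry contributes at least k/(2b) to the exponent,
however the missing entries are distributed. -/
theorem prod_card_div_le {k b : ℕ} (hkb : k ≤ b) (hk : 0 < k) (c : Fin k → ℕ)
    (hc : ∀ i, c i ≤ subtableSize k b i) :
    ∏ i, ((c i : ℝ) / subtableSize k b i) ≤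
      Real.exp (-(k * (b - ∑ i, (c i : ℝ)) / (2 * b))) := by
  have hb : (0 : ℝ) < b := by exact_mod_cast hk.trans_le hkb
  have hsum : ∑ i, (subtableSize k b i : ℝ) = b := by exact_mod_cast sum_subtableSize hk b
  have hle : ∀ i, ((c i : ℝ) / subtableSize k b i) ≤
      Real.exp (-((subtableSize k b i - c i) * (k / (2 * b)))) := fun i => by
    have hpos : (0 : ℝ) < subtableSize k b i := by exact_mod_cast subtableSize_pos hkb i
    have hci : (c i : ℝ) ≤ subtableSize k b i := by exact_mod_cast hc i
    have hmul : (subtableSize k b i : ℝ) * k ≤ 2 * b := by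
      have := Nat.div_mul_le_self (b + i) k
      have hi := i.isLt
      exact_mod_cast (show (b + i) / k * k ≤ 2 * b by omega)
    refine le_trans ?_ (Real.add_one_le_exp _)
    have h1 : (k : ℝ) / (2 * b) ≤ 1 / subtableSize k b i := by
      rw [div_le_div_iff₀ (by positivity) hpos]
      linarith
    have h2 := mul_le_mul_of_nonneg_left h1 (sub_nonneg.2 hci)
    have h3 : ((subtableSize k b i : ℝ) - c i) * (1 / subtableSize k b i) =
        1 - c i / subtableSize k b i := by
      field_simp
    linarith
  refine (Finset.prod_le_prod (fun i _ => by positivity) fun i _ => hle i).trans_eq ?_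
  rw [← Real.exp_sum, Finset.sum_neg_distrib, ← Finset.sum_mul, Finset.sum_sub_distrib, hsum]
  congr 1
  ring

open Classical in
/-- The probability that all entries of a random location are in a set `S` of entries. -/
theorem uniform_locationsIn_le {k b : ℕ} (hkb : k ≤ b) (hk : 0 < k)
    [Fintype (Location k b)] [Nonempty (Location k b)] (S : Finset (Entry k b)) :
    (PMF.uniformOfFintype (Location k b)).toMeasure (locationsIn S) ≤
      ENNReal.ofReal (Real.exp (-(k * (b - S.card) / (2 * b)))) := by
  set c : (i : Fin k) → Finset (Fin (subtableSize k b i)) := fun i =>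
    Finset.univ.filter fun j => ⟨i, j⟩ ∈ S
  have hset : locationsIn S = (Fintype.piFinset c : Set (Location k b)) := by
    ext r
    simp [locationsIn, c]
  have hsum : ∑ i, (c i).card = S.card := by
    rw [← Finset.card_sigma]
    congr 1
    ext ⟨i, j⟩
    simp [c]
  rw [PMF.toMeasure_uniformOfFintype_apply _ .of_discrete]
  have hcard : Fintype.card (locationsIn S) = ∏ i, (c i).card := by
    rw [← Fintype.card_piFinset, ← Set.toFinset_card]
    congr 1
    ext r
    simp [hset]
  have hloc : Fintype.card (Location k b) = ∏ i, subtableSize k b i := by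
    rw [← Nat.card_eq_fintype_card, Nat.card_pi]
    simp
  have hpos : 0 < ∏ i, subtableSize k b i := Finset.prod_pos fun i _ => subtableSize_pos hkb i
  rw [hcard, hloc, ← ENNReal.ofReal_natCast, ← ENNReal.ofReal_natCast,
    ← ENNReal.ofReal_div_of_pos (by exact_mod_cast hpos)]
  refine ENNReal.ofReal_le_ofReal ?_
  have key := prod_card_div_le hkb hk (fun i => (c i).card)
    fun i => by simpa using Finset.card_le_univ (c i)
  rw [Finset.prod_div_distrib] at key
  have hsum' : ∑ i, ((c i).card : ℝ) = S.card := by exact_mod_cast hsum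
  rw [hsum'] at key
  exact_mod_cast key

theorem sum_choose_mul_choose_le {n b q : ℕ} {p : ℝ≥0∞} (h : b * q * p ≤ 1) :
    ∑ s ∈ Finset.Icc 1 n, (b.choose s : ℝ≥0∞) * (q.choose s * p ^ s) ≤ n * (b * q * p) := by
  calc _ ≤ ∑ s ∈ Finset.Icc 1 n, (b * q * p : ℝ≥0∞) := Finset.sum_le_sum fun s hs => by
        have h1 : (b.choose s : ℝ≥0∞) ≤ b ^ s := by exact_mod_cast Nat.choose_le_pow b s
        have h2 : (q.choose s : ℝ≥0∞) ≤ q ^ s := by exact_mod_cast Nat.choose_le_pow q s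
        calc (b.choose s : ℝ≥0∞) * (q.choose s * p ^ s) ≤ b ^ s * (q ^ s * p ^ s) := by gcongr
          _ = (b * q * p) ^ s := by ring
          -- This is where `s ≥ 1` and the hypothesis that the base is at most 1 enter.
          _ ≤ b * q * p := pow_le_of_le_one zero_le h (by have := (Finset.mem_Icc.1 hs).1; omega)
    _ = _ := by simp

/-- A bound for the failure probability that is linear in the number `m` of steps after which the
adversary is cut off. -/
theorem failureProb_le {U : Type u} {V : Type v} {k b n : ℕ} (hkb : k ≤ b) (hk : 0 < k)
    (hn : 0 < n) (hnb : n ≤ b) (A : (CH U V k b 1 0 hkb).Adversary) {m : ℕ} (hm : 0 < m) :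
    (CH U V k b 1 0 hkb).failureProb n A ≤ (CH U V k b 1 0 hkb).expectedTime A / m +
      n * (b * (m + n : ℕ) * ENNReal.ofReal (Real.exp (-(k * (b - n) / (2 * b))))) := by
  classical
  have hne := location_nonempty hkb
  let := Fintype.ofFinite (Location k b)
  set ν := (PMF.uniformOfFintype (Location k b)).toMeasure
  have : IsProbabilityMeasure OracleMachine.coins := isProbabilityMeasure_randomFunction _ _
  let A' : OracleMachine U (Location k b) (Finset (U × V)) := A
  let P := (Measure.infinitePi fun _ : U => ν).prod OracleMachine.coins
  have hP : IsProbabilityMeasure P := inferInstanceAs (IsProbabilityMeasure (Measure.prod _ _))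
  set p := ENNReal.ofReal (Real.exp (-(k * (b - n) / (2 * b))))
  change P {p | ∃ i X, A'.HaltsAt p.1 p.2 i X ∧ X.card = n ∧
      Set.InjOn Prod.fst (X : Set (U × V)) ∧ (CH U V k b 1 0 hkb).construct p.1 X = none} ≤
    (∫⁻ p, A'.time p.1 p.2 ∂P) / m + _
  -- Otherwise the claimed bound exceeds 1 and there is nothing to prove.
  by_cases h1 : b * (m + n : ℕ) * p ≤ 1
  swap
  · refine prob_le_one.trans (le_add_left ?_)
    calc (1 : ℝ≥0∞) ≤ 1 * (b * (m + n : ℕ) * p) := by rw [one_mul]; exact (not_le.1 h1).le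
      _ ≤ _ := by gcongr; exact_mod_cast hn
  set E : Finset (Entry k b) → Set ((U → Location k b) × (ℕ → Bool)) := fun S =>
    {p | ∃ X, A'.HaltsAt p.1 p.2 m X ∧ (X.image Prod.fst).card ≤ n ∧
      ∃ Y ⊆ X.image Prod.fst, S.card ≤ Y.card ∧ ∀ x ∈ Y, p.1 x ∈ locationsIn S}
  have hsub : {p | ∃ i X, A'.HaltsAt p.1 p.2 i X ∧ X.card = n ∧
      Set.InjOn Prod.fst (X : Set (U × V)) ∧ (CH U V k b 1 0 hkb).construct p.1 X = none} ⊆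
      {p | ¬ ∃ X, A'.HaltsAt p.1 p.2 m X} ∪
        ⋃ s ∈ Finset.Icc 1 n, ⋃ S ∈ Finset.powersetCard s Finset.univ, E S := by
    rintro q ⟨i, X, hX, hcard, hinj, hfail⟩
    by_cases hm : ∃ X, A'.HaltsAt q.1 q.2 m X
    swap
    · exact Or.inl hm
    right
    obtain ⟨X', hX'⟩ := hm
    obtain rfl := hX.output_eq hX'
    obtain ⟨Y, hY, hY0, S, hSY, hS⟩ :=
      exists_of_construct_eq_none hkb hk (hcard.trans_le hnb) hinj hfail
    have hXn : (X.image Prod.fst).card ≤ n := Finset.card_image_le.trans hcard.le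
    have hYn := (Finset.card_le_card hY).trans hXn
    exact Set.mem_biUnion (x := S.card) (Finset.mem_Icc.2 ⟨by omega, by omega⟩)
      (Set.mem_biUnion (x := S) (by simp) ⟨X, hX', hXn, Y, hY, hSY.le, hS⟩)
  refine (measure_mono hsub).trans ((measure_union_le _ _).trans (add_le_add ?_ ?_))
  · rw [ENNReal.le_div_iff_mul_le (Or.inl (by exact_mod_cast hm.ne')) (by simp), mul_comm]
    exact A'.measure_not_haltsAt_le P m
  · refine le_trans ?_ (sum_choose_mul_choose_le h1)
    refine (measure_biUnion_finset_le _ _).trans (Finset.sum_le_sum fun s hs => ?_)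
    have hE : ∀ S ∈ Finset.powersetCard s (Finset.univ : Finset (Entry k b)),
        P (E S) ≤ (m + n).choose s * p ^ s := fun S hS => by
      have hSs := (Finset.mem_powersetCard.1 hS).2
      refine (A'.measure_haltsAt_le ν _ (fun X => X.image Prod.fst) n m S.card
        (locationsIn S)).trans ?_
      rw [hSs]
      gcongr
      refine (uniform_locationsIn_le hkb hk S).trans
        (ENNReal.ofReal_le_ofReal (Real.exp_le_exp.2 ?_))
      -- Replacing `S.card` by `n` gives one `p` that serves all `s ≤ n`.
      have : (S.card : ℝ) ≤ n := by
        rw [hSs]; exact_mod_cast (Finset.mem_Icc.1 hs).2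
      gcongr
    refine (measure_biUnion_finset_le _ _).trans ((Finset.sum_le_sum hE).trans_eq ?_)
    rw [Finset.sum_const, Finset.card_powersetCard, Finset.card_univ, card_entry hk, nsmul_eq_mul]

end Cuckoo

/-! ### Polynomial growth against `exp (-2 * f)`. -/

/-- `g` grows at most polynomially. -/
def PolynomiallyBounded (g : ℕ → ℝ) : Prop :=
  ∃ c : ℕ, g =O[atTop] fun x : ℕ => (x : ℝ) ^ c

namespace PolynomiallyBounded

variable {g g₁ g₂ : ℕ → ℝ}

theorem const (a : ℝ) : PolynomiallyBounded fun _ => a :=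
  ⟨0, by simpa using isBigO_const_const a (one_ne_zero (α := ℝ)) (atTop : Filter ℕ)⟩

theorem add (h₁ : PolynomiallyBounded g₁) (h₂ : PolynomiallyBounded g₂) :
    PolynomiallyBounded fun x => g₁ x + g₂ x := by
  obtain ⟨c, hc⟩ := h₁
  obtain ⟨d, hd⟩ := h₂
  have hmono : ∀ {e : ℕ}, e ≤ max c d →
      (fun x : ℕ => (x : ℝ) ^ e) =O[atTop] fun x : ℕ => (x : ℝ) ^ max c d := fun {e} he =>
    .of_norm_eventuallyLE <| by
      filter_upwards [eventually_ge_atTop 1] with x hx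
      rw [Real.norm_of_nonneg (by positivity)]
      exact pow_le_pow_right₀ (by exact_mod_cast hx) he
  exact ⟨max c d, (hc.trans (hmono (le_max_left _ _))).add (hd.trans (hmono (le_max_right _ _)))⟩

theorem mul (h₁ : PolynomiallyBounded g₁) (h₂ : PolynomiallyBounded g₂) :
    PolynomiallyBounded fun x => g₁ x * g₂ x := by
  obtain ⟨c, hc⟩ := h₁
  obtain ⟨d, hd⟩ := h₂
  exact ⟨c + d, by simpa only [pow_add] using hc.mul hd⟩

theorem mono (h : PolynomiallyBounded g₂) (hg : ∀ x, ‖g₁ x‖ ≤ g₂ x) : PolynomiallyBounded g₁ := by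
  obtain ⟨c, hc⟩ := h
  exact ⟨c, (IsBigO.of_norm_le hg).trans hc⟩

theorem eval_mvPolynomial {n : ℕ → ℕ} (hn : PolynomiallyBounded fun x => n x)
    (t : MvPolynomial (Fin 2) ℕ) :
    PolynomiallyBounded fun x => (MvPolynomial.eval ![n x, x] t : ℕ) := by
  induction t using MvPolynomial.induction_on with
  | C a => simpa using const (a : ℝ)
  | add p q hp hq => simpa using hp.add hq
  | mul_X p i hp =>
    have hX : PolynomiallyBounded fun x => ((![n x, x] : Fin 2 → ℕ) i : ℕ) := by
      fin_cases i
      · simpa using hn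
      · exact ⟨1, by simpa using isBigO_refl _ _⟩
    simpa using hp.mul hX

/-- A polynomially bounded function is beaten by `exp (-2 * f)` if `f` grows faster than `log`. -/
theorem eventually_mul_exp_le (h : PolynomiallyBounded g) {f : ℕ → ℝ}
    (hf : (fun x : ℕ => Real.log x) =o[atTop] f) (hf0 : ∀ x, 0 ≤ f x) :
    ∀ᶠ x in atTop, g x * Real.exp (-(2 * f x)) ≤ 1 / 2 := by
  obtain ⟨d, hd⟩ := h
  obtain ⟨K, hK⟩ := hd.bound
  -- The constant 1/(d+2) yields exp(-f) ≤ x^(-(d+2)), while x ≥ K absorbs the implied constant into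
  -- x^(d+1). The quotient 1/x is at most 1/2.
  filter_upwards [hK, hf.bound (c := 1 / (d + 2)) (by positivity), eventually_ge_atTop 2,
    tendsto_natCast_atTop_atTop.eventually_ge_atTop K] with x hx hlog hx2 hxK
  have hx2' : (2 : ℝ) ≤ x := by exact_mod_cast hx2
  have hx0 : (0 : ℝ) < x := by linarith
  rw [Real.norm_of_nonneg (by positivity : (0 : ℝ) ≤ (x : ℝ) ^ d)] at hx
  rw [Real.norm_of_nonneg (hf0 x), Real.norm_of_nonneg (Real.log_nonneg (by linarith)),
    one_div, inv_mul_eq_div, le_div_iff₀ (by positivity)] at hlog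
  have hg : g x ≤ x ^ (d + 1) := by
    rw [pow_succ']
    exact (le_abs_self _).trans (hx.trans (by gcongr))
  have hexp : Real.exp (-(2 * f x)) ≤ ((x : ℝ) ^ (d + 2))⁻¹ := by
    rw [← Real.exp_log (by positivity : (0 : ℝ) < x ^ (d + 2)), ← Real.exp_neg, Real.log_pow]
    refine Real.exp_le_exp.2 ?_
    have := hf0 x
    push_cast
    linarith
  calc g x * Real.exp (-(2 * f x)) ≤ x ^ (d + 1) * ((x : ℝ) ^ (d + 2))⁻¹ := by gcongr
    _ = 1 / x := by
        field_simp
        ring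
    _ ≤ 1 / 2 := by gcongr

end PolynomiallyBounded

/-! ### Choice of the cut-off and conclusion. -/

namespace Cuckoo

/-- A concrete bound for the failure probability of an adversary with expected time at most `T`. -/
theorem failureProb_le_ofReal {U : Type u} {V : Type v} {k b n T : ℕ} (hkb : k ≤ b) (hk : 0 < k)
    (hn : 0 < n) {α f ε : ℝ} (hα : 1 < α) (hb : α * n ≤ b) (hε0 : 0 < ε) (hε1 : ε < 1)
    (hkf : 4 / (1 - 1 / α) * (f + Real.log (1 / ε)) ≤ k)
    (hf : n * b * (2 * T + 3 + n : ℝ) * Real.exp (-(2 * f)) ≤ 1 / 2)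
    (A : (CH U V k b 1 0 hkb).Adversary) (hA : (CH U V k b 1 0 hkb).expectedTime A ≤ T) :
    (CH U V k b 1 0 hkb).failureProb n A ≤ ENNReal.ofReal ε := by
  have hn0 : (0 : ℝ) < n := by exact_mod_cast hn
  have hnb' : (n : ℝ) ≤ b := by nlinarith
  have hnb : n ≤ b := by exact_mod_cast hnb'
  have hb0 : (0 : ℝ) < b := by linarith
  -- The cut-off makes the Markov term at most ε/2; `T + 1` keeps it positive when `T = 0`.
  set m := ⌈2 * (T + 1 : ℝ) / ε⌉₊
  have hm_ge : 2 * (T + 1 : ℝ) / ε ≤ m := Nat.le_ceil _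
  have hm_le : (m : ℝ) ≤ 2 * (T + 1 : ℝ) / ε + 1 := (Nat.ceil_lt_add_one (by positivity)).le
  have hm0 : (0 : ℝ) < m := lt_of_lt_of_le (by positivity) hm_ge
  have hm : 0 < m := by exact_mod_cast hm0
  refine (failureProb_le hkb hk hn hnb A hm).trans ?_
  have hγ : 0 < 1 - 1 / α := by
    rw [sub_pos, div_lt_one (by linarith)]
    exact hα
  have hp : Real.exp (-(k * (b - n) / (2 * b))) ≤ ε ^ 2 * Real.exp (-(2 * f)) := by
    have h1 : ε ^ 2 * Real.exp (-(2 * f)) = Real.exp (-(2 * (f + Real.log (1 / ε)))) := by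
      rw [one_div, Real.log_inv, ← Real.exp_log (pow_pos hε0 2), ← Real.exp_add, Real.log_pow]
      congr 1
      push_cast
      ring_nf
    rw [h1]
    refine Real.exp_le_exp.2 (neg_le_neg ?_)
    -- The load gap b - n ≥ (1 - 1/α)b explains the factor 4/(1 - 1/α): it leaves exactly 2(f +
    -- log(1/ε)) in the exponent.
    have h2 : (1 - 1 / α) / 2 ≤ (b - n) / (2 * b) := by
      rw [div_le_div_iff₀ (by positivity) (by positivity)]
      have : (n : ℝ) ≤ 1 / α * b := by
        rw [one_div, inv_mul_eq_div, le_div_iff₀ (by linarith)]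
        linarith
      nlinarith
    calc 2 * (f + Real.log (1 / ε))
        = 4 / (1 - 1 / α) * (f + Real.log (1 / ε)) * ((1 - 1 / α) / 2) := by
          rw [div_mul_eq_mul_div, div_mul_div_comm, mul_comm (1 - 1 / α) 2,
            mul_div_mul_right _ _ hγ.ne']
          ring
      _ ≤ k * ((b - n) / (2 * b)) := by gcongr
      _ = _ := by ring
  have hfirst : (T : ℝ) / m ≤ ε / 2 := by
    rw [div_le_iff₀ hε0] at hm_ge
    rw [div_le_div_iff₀ hm0 (by norm_num)]
    linarith
  have hsecond : (n : ℝ) * (b * (m + n : ℕ) * Real.exp (-(k * (b - n) / (2 * b)))) ≤ ε / 2 := by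
    have hmn : (m + n : ℝ) * ε ≤ 2 * T + 3 + n := by
      have h1 : (m : ℝ) * ε ≤ 2 * (T + 1) + ε := by
        calc (m : ℝ) * ε ≤ (2 * (T + 1 : ℝ) / ε + 1) * ε := by gcongr
          _ = _ := by field_simp
      nlinarith
    push_cast
    calc (n : ℝ) * (b * (m + n) * Real.exp (-(k * (b - n) / (2 * b))))
        ≤ n * (b * (m + n) * (ε ^ 2 * Real.exp (-(2 * f)))) := by gcongr
      _ = ε * (n * b * ((m + n) * ε) * Real.exp (-(2 * f))) := by ring
      _ ≤ ε * (n * b * (2 * T + 3 + n) * Real.exp (-(2 * f))) := by gcongr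
      _ ≤ ε * (1 / 2) := by gcongr
      _ = _ := by ring
  calc _ ≤ ENNReal.ofReal (T / m) +
        ENNReal.ofReal (n * (b * (m + n : ℕ) * Real.exp (-(k * (b - n) / (2 * b))))) := by
        refine add_le_add ?_ (le_of_eq ?_)
        · rw [ENNReal.ofReal_div_of_pos hm0, ENNReal.ofReal_natCast, ENNReal.ofReal_natCast]
          gcongr
        · rw [ENNReal.ofReal_mul (by positivity), ENNReal.ofReal_mul (by positivity),
            ENNReal.ofReal_mul (by positivity)]
          simp only [ENNReal.ofReal_natCast]
    _ ≤ ENNReal.ofReal (ε / 2) + ENNReal.ofReal (ε / 2) := by gcongr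
    _ = ENNReal.ofReal ε := by
        rw [← ENNReal.ofReal_add (by positivity) (by positivity), add_halves]

end Cuckoo

theorem mainTheorem5 (α : ℝ) (hα : 1 < α) :
    ∃ C : ℝ, 0 < C ∧
      ∀ (U : ℕ → Type u) (V : ℕ → Type v) (f : ℕ → ℝ) (ε : ℕ → ℝ) (n k : ℕ → ℕ)
        (hkb : ∀ lam, k lam ≤ ⌈α * n lam⌉₊),
        (∀ lam, 0 ≤ f lam) →
        (fun lam : ℕ => Real.log lam) =o[atTop] f →
        (∀ lam, 0 < ε lam ∧ ε lam < 1) →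
        (∃ c : ℕ, (fun lam => (n lam : ℝ)) =O[atTop] fun lam : ℕ => (lam : ℝ) ^ c) →
        (∀ lam, C * (f lam + Real.log (1 / ε lam)) ≤ k lam) →
        HashingScheme.IsStronglyRobust
          (fun lam => Cuckoo.CH (U lam) (V lam) (k lam) ⌈α * n lam⌉₊ 1 0 (hkb lam)) n ε := by
  have hγ : 0 < 1 - 1 / α := by
    rw [sub_pos, div_lt_one (by linarith)]
    exact hα
  refine ⟨4 / (1 - 1 / α), by positivity, ?_⟩
  rintro U V f ε n k hkb hf0 hf hε hn hk t A ⟨c, hc⟩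
  have hn : PolynomiallyBounded fun x => n x := hn
  have hb : PolynomiallyBounded fun x => (⌈α * n x⌉₊ : ℝ) := by
    refine (((PolynomiallyBounded.const α).mul hn).add (.const 1)).mono fun x => ?_
    rw [Real.norm_of_nonneg (by positivity)]
    exact (Nat.ceil_lt_add_one (by positivity)).le
  have hT : PolynomiallyBounded fun x => ((c * MvPolynomial.eval ![n x, x] t : ℕ) : ℝ) := by
    simpa using (PolynomiallyBounded.const (c : ℝ)).mul (.eval_mvPolynomial hn t)
  have hG := (hn.mul hb).mul ((((PolynomiallyBounded.const 2).mul hT).add (.const 3)).add hn)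
  filter_upwards [hc, hG.eventually_mul_exp_le hf hf0] with x hx hGx
  have hk0 : 0 < k x := by
    have hlog : 0 < Real.log (1 / ε x) :=
      Real.log_pos (by rw [lt_div_iff₀ (hε x).1]; linarith [(hε x).2])
    have : 0 < 4 / (1 - 1 / α) * (f x + Real.log (1 / ε x)) :=
      mul_pos (by positivity) (add_pos_of_nonneg_of_pos (hf0 x) hlog)
    exact_mod_cast this.trans_le (hk x)
  -- If `n x = 0` there are no entries, so `k x ≤ 0`, contrary to `hk0`.
  have hn0 : 0 < n x := by
    by_contra! h
    have hkx := hkb x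
    rw [Nat.le_zero.1 h] at hkx
    simp at hkx
    omega
  exact Cuckoo.failureProb_le_ofReal (hkb x) hk0 hn0 hα (Nat.le_ceil _) (hε x).1 (hε x).2 (hk x)
    hGx (A x) hx
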